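/- A \emph{solution} is a pair $(X,r)$ with $X$ a non-empty set and $r:X\times X\to X\times X$, $r(x,y)=(\sigma_x(y),\tau_y(x))$, a bijection such that $(r\times 1)(1\times r)(r\times 1)=(1\times r)(r\times 1)(1\times r)$ on $X\times X\times X$, all maps $\sigma_x,\tau_y$ are bijections of $X$, and $r^2=\mathrm{id}$ (a non-degenerate involutive set-theoretic solution of the Yang--Baxter equation). Its \emph{permutation group} is the group of permutations of $X$ generated by the maps $\sigma_x$, $x\in X$; the solution is \emph{indecomposable} if this group acts transitively on $X$. Two solutions $(X,r)$ and $(Y,s)$ are isomorphic if there is a bijection $f:X\to Y$ with $s\circ(f\times f)=(f\times f)\circ r$. We say that a solution has permutation group $G$ if its permutation group is isomorphic to $G$, and the size of a solution is the cardinality of $X$. \textbf{Theorem.} Let $p$ and $q$ be primes with $p\equiv 1\pmod q$. Let $g$ be an element of order $q$ in $(\mathbb{Z}/p^2)^{\times}$, and let $\mathbb{Z}_{p^2}\rtimes\mathbb{Z}_q$ be the semidirect product in which the generator $1$ of $\mathbb{Z}_q$ acts on $\mathbb{Z}_{p^2}$ by multiplication by $g$. Then, up to isomorphism, there are exactly $q-1$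 indecomposable solutions with permutation group $\mathbb{Z}_{p^2}\rtimes\mathbb{Z}_q$, and all such solutions have size $p^2q$. \textbf{Corollary.} Let $p$ be an odd prime. Then, up to isomorphism, there is exactly one indecomposable solution whose permutation group is the dihedral group $D_{2p^2}$ of order $2p^2$, and it has size $2p^2$. -/

import Mathlib

universe u

/-- A non-degenerate involutive set-theoretic solution `(X, r)` of the Yang-Baxter equation,
on a non-empty set `X`; the maps `σ x` and `τ y` are given by `r (x, y) = (σ x y, τ y x)`. -/
structure YBSolution : Type (u + 1) where
  X : Type u
  nonempty : Nonempty X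
  r : X × X → X × X
  bijective : Function.Bijective r
  /-- `(r × 1) (1 × r) (r × 1) = (1 × r) (r × 1) (1 × r)` as maps of `X × X × X`. -/
  braid :
    let r₁ : X × X × X → X × X × X := fun t =>
      ((r (t.1, t.2.1)).1, (r (t.1, t.2.1)).2, t.2.2)
    let r₂ : X × X × X → X × X × X := fun t => (t.1, r t.2)
    r₁ ∘ r₂ ∘ r₁ = r₂ ∘ r₁ ∘ r₂
  bijective_σ : ∀ x, Function.Bijective fun y => (r (x, y)).1
  bijective_τ : ∀ y, Function.Bijective fun x => (r (x, y)).2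
  involutive : ∀ t, r (r t) = t

namespace YBSolution

/-- The permutation `σ x` of `X`. -/
noncomputable def σ (S : YBSolution.{u}) (x : S.X) : Equiv.Perm S.X :=
  Equiv.ofBijective (fun y => (S.r (x, y)).1) (S.bijective_σ x)

/-- The permutation group of a solution: the group generated by the permutations `σ x`. -/
def permutationGroup (S : YBSolution.{u}) : Subgroup (Equiv.Perm S.X) :=
  Subgroup.closure (Set.range S.σ)

/-- A solution is indecomposable if its permutation group acts transitively on it. -/
def Indecomposable (S : YBSolution.{u}) : Prop :=
  ∀ x y : S.X, ∃ f ∈ S.permutationGroup, f x = y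

/-- `S` and `T` are isomorphic: there is a bijection intertwining the maps `r`. -/
def Isomorphic (S T : YBSolution.{u}) : Prop :=
  ∃ f : S.X ≃ T.X, ∀ x y, T.r (f x, f y) = (f (S.r (x, y)).1, f (S.r (x, y)).2)

theorem isomorphic_equivalence : Equivalence Isomorphic.{u} where
  refl S := ⟨Equiv.refl _, fun _ _ => rfl⟩
  symm := by
    rintro S T ⟨f, hf⟩
    refine ⟨f.symm, fun x y => ?_⟩
    have h := hf (f.symm x) (f.symm y)
    simp only [Equiv.apply_symm_apply] at h
    simp [h]
  trans := by
    rintro S T U ⟨f, hf⟩ ⟨k, hk⟩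
    exact ⟨f.trans k, fun x y => by simp [hk, hf]⟩

/-- `S` is an indecomposable solution whose permutation group is isomorphic to `G`. -/
def IsIndecomposableWith (G : Type*) [Group G] (S : YBSolution.{u}) : Prop :=
  S.Indecomposable ∧ Nonempty (S.permutationGroup ≃* G)

/-- Isomorphism, as an equivalence relation on the indecomposable solutions with permutation
group `G`. -/
def isoSetoid (G : Type*) [Group G] : Setoid {S : YBSolution.{u} // IsIndecomposableWith G S} where
  r S T := Isomorphic S.1 T.1
  iseqv := isomorphic_equivalence.comap Subtype.val

/-- The isomorphism classes of indecomposable solutions with permutation group `G`. -/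
def IndecomposableClasses (G : Type*) [Group G] : Type (u + 1) :=
  Quotient (isoSetoid.{u} G)

end YBSolution

/-- Multiplication by a unit of `ℤ/n`, as an automorphism of the additive group of `ℤ/n`
(written multiplicatively). -/
def mulUnitAut (n : ℕ) : (ZMod n)ˣ →* MulAut (Multiplicative (ZMod n)) where
  toFun g :=
    { toFun := fun a => Multiplicative.ofAdd ((g : ZMod n) * a.toAdd)
      invFun := fun a => Multiplicative.ofAdd (((g⁻¹ : (ZMod n)ˣ) : ZMod n) * a.toAdd)
      left_inv := fun a => by simp
      right_inv := fun a => by simp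
      map_mul' := fun a b => by simp [mul_add] }
  map_one' := by ext a; simp
  map_mul' g h := by ext a; simp [mul_assoc]

/-- For a unit `g` of `ℤ/n` of order `q`, the action of `ℤ/q` on `ℤ/n` in which `b` acts as
multiplication by `g ^ b`; in particular the generator `1` acts as multiplication by `g`. -/
def unitAction (n q : ℕ) (g : (ZMod n)ˣ) (hg : orderOf g = q) :
    Multiplicative (ZMod q) →* MulAut (Multiplicative (ZMod n)) where
  toFun b := mulUnitAut n (g ^ (b.toAdd.cast : ℤ))
  map_one' := by simp
  map_mul' b c := by
    rw [← map_mul, ← zpow_add]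
    congr 1
    rw [zpow_eq_zpow_iff_modEq, hg, ← ZMod.intCast_eq_intCast_iff]
    simp

/-- The semidirect product `ℤ/n ⋊ ℤ/q` in which the generator `1` of `ℤ/q` acts on `ℤ/n` as
multiplication by the unit `g` of order `q`. -/
abbrev CyclicSemidirect (n q : ℕ) (g : (ZMod n)ˣ) (hg : orderOf g = q) : Type :=
  Multiplicative (ZMod n) ⋊[unitAction n q g hg] Multiplicative (ZMod q)

/-! The finite permutation group `G` of a solution is a left brace: there are an abelian group `A`,
an action of `G` on `A` and a bijective 1-cocycle `c : G → A`, with `f ∈ G` sending `c (σ x)` to `c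
(σ (f x))`. So the plan is to determine the braces on `G = ℤ/p² ⋊ ℤ/q`, and then the orbits of the
action that generate `G`.

There is one brace up to automorphisms of `G`. The `p²`-torsion of `A` corresponds to `ℤ/p²`, and
after a conjugation `(0, 1)` corresponds to an element of the `q`-torsion. Counting fixed points
shows that `G` acts trivially on the `q`-torsion, which has only `q < p` elements. The `p²`-torsion
is cyclic because `p` is odd; its endomorphisms commute, so the elements `(a, 0)`, which are powers
of a commutator, act trivially on it. Hence `(a, i)` sends `c (b, j)` to `c (g ^ i * b, j)`
(`exists_mulAut`).

If `σ x₀ = (b, j)`, transitivity makes the maps `σ x` exactly the elements `(g ^ i * b, j)`. They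
generate `G`, so `j ≠ 0` and `b` is a unit, which an automorphism scales to `1`. A stabilizer lies
in `ℤ/p²`, all of whose subgroups are normal in `G`, so it is trivial and `X` is a copy of `G`
(`exists_equiv`). The parameter `j` is an invariant because automorphisms of `G` fix the second
coordinate. This leaves the `q - 1` nonzero values of `j`. The dihedral group is the case `q = 2`,
`g = -1`. -/

namespace CyclicSemidirect

/-! ### Coordinates in the semidirect product. -/

variable {n q : ℕ} {g : (ZMod n)ˣ} {hg : orderOf g = q}

/-- The element `(a, i)` of the semidirect product `ℤ/n ⋊ ℤ/q`. -/
def el (a : ZMod n) (i : ZMod q) : CyclicSemidirect n q g hg :=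
  ⟨Multiplicative.ofAdd a, Multiplicative.ofAdd i⟩

/-- The scalar `g ^ i` by which `i : ℤ/q` acts on `ℤ/n`. -/
def scalar (g : (ZMod n)ˣ) (i : ZMod q) : ZMod n :=
  ((g ^ (i.cast : ℤ) : (ZMod n)ˣ) : ZMod n)

theorem exists_el (c : CyclicSemidirect n q g hg) : ∃ a i, c = el a i :=
  ⟨c.left.toAdd, c.right.toAdd, rfl⟩

theorem el_inj {a b : ZMod n} {i j : ZMod q} :
    (el a i : CyclicSemidirect n q g hg) = el b j ↔ a = b ∧ i = j := by
  constructor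
  · intro h
    exact ⟨congrArg (fun c => c.left.toAdd) h, congrArg (fun c => c.right.toAdd) h⟩
  · rintro ⟨rfl, rfl⟩
    rfl

theorem el_zero : (el 0 0 : CyclicSemidirect n q g hg) = 1 := rfl

theorem el_mul (a b : ZMod n) (i j : ZMod q) :
    (el a i * el b j : CyclicSemidirect n q g hg) = el (a + scalar g i * b) (i + j) := rfl

theorem scalar_add (hg : orderOf g = q) (i j : ZMod q) :
    scalar g (i + j) = scalar g i * scalar g j := by
  rw [scalar, scalar, scalar, ← Units.val_mul, ← zpow_add, Units.val_inj,
    zpow_eq_zpow_iff_modEq, hg, ← ZMod.intCast_eq_intCast_iff]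
  simp

theorem scalar_zero : scalar g (0 : ZMod q) = 1 := by simp [scalar]

theorem scalar_one (hg : orderOf g = q) : scalar g (1 : ZMod q) = g := by
  have : g ^ ((1 : ZMod q).cast : ℤ) = g ^ (1 : ℤ) := by
    rw [zpow_eq_zpow_iff_modEq, hg, ← ZMod.intCast_eq_intCast_iff]
    simp
  rw [scalar, this, zpow_one]

theorem scalar_injective (hg : orderOf g = q) :
    Function.Injective (scalar g : ZMod q → ZMod n) := by
  intro i j h
  rw [scalar, scalar, Units.val_inj, zpow_eq_zpow_iff_modEq, hg,
    ← ZMod.intCast_eq_intCast_iff] at h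
  simpa using h

theorem el_inv (a : ZMod n) (i : ZMod q) :
    (el a i : CyclicSemidirect n q g hg)⁻¹ = el (-(scalar g (-i) * a)) (-i) := by
  rw [inv_eq_iff_mul_eq_one, el_mul, ← el_zero, el_inj, mul_neg, ← mul_assoc,
    ← scalar_add (g := g) hg]
  simp [scalar_zero]

theorem el_pow (a : ZMod n) (k : ℕ) :
    (el a 0 : CyclicSemidirect n q g hg) ^ k = el ((k : ZMod n) * a) 0 := by
  induction k with
  | zero => simp [el_zero]
  | succ k ih => rw [pow_succ, ih, el_mul, el_inj]; simp [scalar_zero, add_mul]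

theorem el_zero_pow (i : ZMod q) (k : ℕ) :
    (el 0 i : CyclicSemidirect n q g hg) ^ k = el 0 ((k : ZMod q) * i) := by
  induction k with
  | zero => simp [el_zero]
  | succ k ih => rw [pow_succ, ih, el_mul, el_inj]; simp [add_mul]

theorem right_pow (a : ZMod n) (i : ZMod q) (k : ℕ) :
    ∃ b, (el a i : CyclicSemidirect n q g hg) ^ k = el b ((k : ZMod q) * i) := by
  induction k with
  | zero => exact ⟨0, by simp [el_zero]⟩
  | succ k ih =>
    obtain ⟨b, hb⟩ := ih
    exact ⟨_, by rw [pow_succ, hb, el_mul, el_inj]; exact ⟨rfl, by push_cast; ring⟩⟩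

theorem el_conj (a b : ZMod n) (i : ZMod q) :
    (el a i * el b 0 * (el a i)⁻¹ : CyclicSemidirect n q g hg) = el (scalar g i * b) 0 := by
  rw [mul_inv_eq_iff_eq_mul, el_mul, el_mul, el_inj]
  simp [scalar_zero, add_comm]

theorem card_eq [NeZero n] [NeZero q] : Nat.card (CyclicSemidirect n q g hg) = n * q := by
  rw [SemidirectProduct.card]
  simp

instance [NeZero n] [NeZero q] : Finite (CyclicSemidirect n q g hg) :=
  Nat.finite_of_card_ne_zero (by rw [card_eq]; exact mul_ne_zero (NeZero.ne n) (NeZero.ne q))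

end CyclicSemidirect

/-- A unit of `ℤ/p²` of order coprime to `p` and different from `1` is not `1` modulo `p`. -/
theorem isUnit_sub_one_of_orderOf {p q : ℕ} (hp : p.Prime) (hq : q ≠ 1) (hpq : p.Coprime q)
    {g : (ZMod (p ^ 2))ˣ} (hg : orderOf g = q) : IsUnit ((g : ZMod (p ^ 2)) - 1) := by
  have : NeZero (p ^ 2) := ⟨pow_ne_zero _ hp.ne_zero⟩
  by_contra h
  set x : ZMod (p ^ 2) := (g : ZMod (p ^ 2)) - 1 with hx
  have hdvd : p ∣ x.val := by
    by_contra hd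
    apply h
    have := (ZMod.isUnit_iff_coprime x.val (p ^ 2)).2
      (((Nat.Prime.coprime_iff_not_dvd hp).2 hd).symm.pow_right 2)
    simpa using this
  obtain ⟨k, hk⟩ := hdvd
  have hxk : x = p * k := by
    rw [← ZMod.natCast_zmod_val x, hk]; push_cast; rfl
  have hpp : (p : ZMod (p ^ 2)) * p = 0 := by
    rw [← sq]; exact_mod_cast ZMod.natCast_self (p ^ 2)
  -- Since `p` divides `x`, `x ^ 2 = 0` and the binomial expansion stops after the linear term. At
  -- `m = p` this gives `g ^ p = 1`, against the order `q ≠ 1` coprime to `p`.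
  have hpow : ∀ m : ℕ, (1 + x) ^ m = 1 + m * x := by
    intro m
    induction m with
    | zero => simp
    | succ m ih =>
      rw [pow_succ (1 + x) m, ih, hxk, Nat.cast_succ]
      linear_combination ((m : ZMod (p ^ 2)) * k * k) * hpp
  have hgp : g ^ p = 1 := by
    ext
    have : (g : ZMod (p ^ 2)) = 1 + x := by rw [hx]; ring
    rw [Units.val_pow_eq_pow_val, this, hpow, hxk, ← mul_assoc, hpp]
    simp
  have h1 := orderOf_dvd_of_pow_eq_one hgp
  rw [hg] at h1
  exact hq (Nat.Coprime.eq_one_of_dvd hpq.symm h1)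

/-! ### The brace structure on the permutation group. -/

namespace YBSolution

variable (S : YBSolution.{u})

@[simp]
theorem σ_apply (x y : S.X) : S.σ x y = (S.r (x, y)).1 := rfl

/-- By involutivity, `τ y x` is determined by the maps `σ`. -/
theorem r_snd (x y : S.X) : (S.r (x, y)).2 = (S.σ (S.σ x y))⁻¹ x := by
  rw [Equiv.Perm.eq_inv_iff_eq]
  exact congrArg Prod.fst (S.involutive (x, y))

theorem σ_mul_σ (x y : S.X) : S.σ x * S.σ y = S.σ (S.σ x y) * S.σ ((S.r (x, y)).2) := by
  ext z
  exact (congrArg Prod.fst (congrFun S.braid (x, y, z))).symm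

/-- The cycle set equation. -/
theorem σ_mul_σ_inv (x y : S.X) :
    S.σ x * S.σ ((S.σ x)⁻¹ y) = S.σ y * S.σ ((S.σ y)⁻¹ x) := by
  have h := S.σ_mul_σ x ((S.σ x)⁻¹ y)
  rwa [r_snd, ← Equiv.Perm.mul_apply (S.σ x), mul_inv_cancel, Equiv.Perm.one_apply] at h

/-- The step by which the structure monoid acts. -/
noncomputable def step (f : Equiv.Perm S.X) (x : S.X) : Equiv.Perm S.X := f * S.σ (f⁻¹ x)

/-- This is the cycle set equation for `f⁻¹ x` and `f⁻¹ y`. It makes `perm` well defined on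
multisets, hence the addition of the brace commutative. -/
instance : RightCommutative S.step where
  right_comm f x y := by
    simp only [step, mul_inv_rev, Equiv.Perm.mul_apply, mul_assoc]
    rw [σ_mul_σ_inv]

/-- The bijective 1-cocycle of the structure monoid, whose additive monoid is free commutative,
followed by the permutation action. -/
noncomputable def perm (m : Multiset S.X) : Equiv.Perm S.X := m.foldl S.step 1

theorem foldl_step (f h : Equiv.Perm S.X) (m : Multiset S.X) :
    m.foldl S.step (f * h) = f * (m.map ⇑f⁻¹).foldl S.step h := by
  induction m using Multiset.induction generalizing h with
  | empty => simp
  | cons x m ih =>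
    have : S.step (f * h) x = f * S.step h (f⁻¹ x) := by simp [step, mul_assoc]
    rw [Multiset.foldl_cons, this, ih, Multiset.map_cons, Multiset.foldl_cons]

@[simp]
theorem perm_zero : S.perm 0 = 1 := rfl

@[simp]
theorem perm_singleton (x : S.X) : S.perm {x} = S.σ x := by
  simp [perm, ← Multiset.cons_zero, step]

theorem perm_add (m k : Multiset S.X) :
    S.perm (m + k) = S.perm m * S.perm (k.map ⇑(S.perm m)⁻¹) := by
  rw [perm, Multiset.foldl_add, ← mul_one (m.foldl S.step 1), foldl_step]
  rfl

theorem perm_mul (m k : Multiset S.X) :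
    S.perm m * S.perm k = S.perm (m + k.map (S.perm m)) := by
  rw [perm_add, Multiset.map_map]
  simp

theorem perm_mem (m : Multiset S.X) : S.perm m ∈ S.permutationGroup :=
  Multiset.foldl_induction' S.step 1 (fun _ => True) (· ∈ S.permutationGroup) m
    (fun _ _ _ hf => mul_mem hf (Subgroup.subset_closure ⟨_, rfl⟩)) (one_mem _)
    fun _ _ => trivial

/-- By `perm_mul` the values of `perm` form a submonoid; in a finite group inverses are powers, so
it is the whole group. -/
theorem exists_perm_eq [Finite S.permutationGroup] {f : Equiv.Perm S.X}
    (hf : f ∈ S.permutationGroup) : ∃ m, S.perm m = f := by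
  have hpow : ∀ m k, ∃ m', S.perm m' = S.perm m ^ k := by
    intro m k
    induction k with
    | zero => exact ⟨0, by simp⟩
    | succ k ih =>
      obtain ⟨m', h⟩ := ih
      exact ⟨_, by rw [pow_succ, ← h, perm_mul]⟩
  induction hf using Subgroup.closure_induction with
  | mem f hf =>
    obtain ⟨x, rfl⟩ := hf
    exact ⟨{x}, S.perm_singleton x⟩
  | one => exact ⟨0, rfl⟩
  | mul f h _ _ hf hh =>
    obtain ⟨m, rfl⟩ := hf
    obtain ⟨k, rfl⟩ := hh
    exact ⟨_, (S.perm_mul m k).symm⟩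
  | inv f hf ih =>
    obtain ⟨m, rfl⟩ := ih
    have hfin : IsOfFinOrder (S.perm m) := by
      exact Submonoid.isOfFinOrder_coe.2
        (isOfFinOrder_of_finite (⟨_, S.perm_mem m⟩ : S.permutationGroup))
    obtain ⟨k, hk⟩ := hfin.mem_powers_iff_mem_zpowers.2
      (inv_mem (Subgroup.mem_zpowers (S.perm m)))
    obtain ⟨m', hm'⟩ := hpow m k
    exact ⟨m', hm'.trans hk⟩

/-- `perm (m + k)` depends on `m` only through `perm m`, and by commutativity on `k` only through
`perm k`. -/
theorem perm_add_congr {m m' k k' : Multiset S.X} (hm : S.perm m = S.perm m')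
    (hk : S.perm k = S.perm k') : S.perm (m + k) = S.perm (m' + k') := by
  rw [perm_add, hm, ← perm_add, add_comm m' k, perm_add, hk, ← perm_add, add_comm]

/-- The congruence on the free commutative monoid whose quotient is the additive group of the
permutation brace. -/
noncomputable def permCon : AddCon (Multiset S.X) where
  r m k := S.perm m = S.perm k
  iseqv := ⟨fun _ => rfl, fun h => h.symm, fun h h' => h.trans h'⟩
  add' := S.perm_add_congr

/-- If `perm l = f⁻¹`, then `perm (l + m) = f⁻¹ * perm (m.map f)`; congruence of addition and
cancellation give the claim. Thus the action on multisets descends to the additive group. -/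
theorem perm_map_congr [Finite S.permutationGroup] {f : Equiv.Perm S.X}
    (hf : f ∈ S.permutationGroup) {m k : Multiset S.X} (h : S.perm m = S.perm k) :
    S.perm (m.map f) = S.perm (k.map f) := by
  obtain ⟨l, hl⟩ := S.exists_perm_eq (inv_mem hf)
  have h1 := S.perm_add_congr (rfl : S.perm l = S.perm l) h
  rw [perm_add, perm_add, hl, inv_inv] at h1
  exact mul_left_cancel h1

/-- The additive group of the permutation brace. -/
abbrev PermAdd : Type u := S.permCon.Quotient

/-- The additive group structure of the permutation brace. -/
noncomputable abbrev permAddCommGroup [Finite S.permutationGroup] : AddCommGroup S.PermAdd :=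
  have h : ∀ a : S.PermAdd, ∃ b, b + a = 0 := by
    intro a
    induction a using AddCon.induction_on with
    | H m =>
      obtain ⟨k, hk⟩ := S.exists_perm_eq (inv_mem (S.perm_mem m))
      refine ⟨((k.map (S.perm m) : Multiset S.X) : S.PermAdd), ?_⟩
      rw [← AddCon.coe_add, ← AddCon.coe_zero, AddCon.eq, add_comm]
      change S.perm _ = S.perm 0
      rw [← perm_mul, hk, perm_zero, mul_inv_cancel]
  letI : Neg S.PermAdd := ⟨fun a => (h a).choose⟩
  { (inferInstance : AddCommMonoid S.PermAdd) with
    neg := fun a => (h a).choose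
    zsmul := zsmulRec
    neg_add_cancel := fun a => (h a).choose_spec }

end YBSolution

/-- A bijective 1-cocycle of a group `G` with values in an abelian group `A`; equivalently a left
brace with multiplicative group `G` and additive group `A`. -/
structure BijectiveCocycle (G A : Type*) [Group G] [AddCommGroup A] where
  toEquiv : G ≃ A
  act : G →* AddMonoid.End A
  map_mul : ∀ x y, toEquiv (x * y) = toEquiv x + act x (toEquiv y)

namespace YBSolution

/-- The brace structure on the permutation group of a solution. -/
theorem exists_bijectiveCocycle (S : YBSolution.{u}) [Finite S.permutationGroup] :
    ∃ (A : Type u) (_ : AddCommGroup A) (c : BijectiveCocycle S.permutationGroup A),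
      ∀ (f : S.permutationGroup) (x : S.X),
        c.act f (c.toEquiv ⟨S.σ x, Subgroup.subset_closure ⟨x, rfl⟩⟩) =
          c.toEquiv ⟨S.σ (f.1 x), Subgroup.subset_closure ⟨_, rfl⟩⟩ := by
  let _ := S.permAddCommGroup
  let e : S.PermAdd → S.permutationGroup := fun a =>
    AddCon.liftOn a (fun m => ⟨S.perm m, S.perm_mem m⟩) fun m k h => Subtype.ext h
  have he : Function.Bijective e := by
    constructor
    · intro a b
      induction a using AddCon.induction_on
      induction b using AddCon.induction_on
      intro h
      exact (AddCon.eq _).2 (congrArg Subtype.val h)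
    · rintro ⟨f, hf⟩
      obtain ⟨m, rfl⟩ := S.exists_perm_eq hf
      exact ⟨(m : S.PermAdd), rfl⟩
  let E : S.permutationGroup ≃ S.PermAdd := (Equiv.ofBijective e he).symm
  have hE : ∀ m h, E ⟨S.perm m, h⟩ = (m : S.PermAdd) := fun m h =>
    (Equiv.ofBijective e he).symm_apply_eq.2 rfl
  let act : S.permutationGroup →* AddMonoid.End S.PermAdd :=
    { toFun := fun f => AddCon.lift S.permCon
        ((AddCon.mk' S.permCon).comp (Multiset.mapAddMonoidHom f.1))
        fun m k h => (AddCon.eq _).2 (S.perm_map_congr f.2 h)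
      map_one' := by
        ext a
        induction a using AddCon.induction_on with
        | H m => exact congrArg ((↑) : Multiset S.X → S.PermAdd) (Multiset.map_id m)
      map_mul' := fun f h => by
        ext a
        induction a using AddCon.induction_on with
        | H m =>
          exact congrArg ((↑) : Multiset S.X → S.PermAdd) (Multiset.map_map f.1 h.1 m).symm }
  have hact : ∀ f (m : Multiset S.X), act f (m : S.PermAdd) = (m.map f.1 : Multiset S.X) :=
    fun f m => rfl
  refine ⟨S.PermAdd, inferInstance, ⟨E, act, ?_⟩, ?_⟩
  · rintro ⟨f, hf⟩ ⟨h, hh⟩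
    obtain ⟨m, rfl⟩ := S.exists_perm_eq hf
    obtain ⟨k, rfl⟩ := S.exists_perm_eq hh
    simp only [hE, hact, MulMemClass.mk_mul_mk]
    rw [← AddCon.coe_add, ← hE _ (S.perm_mem _)]
    congr 2
    exact S.perm_mul m k
  · intro f x
    have := hE {x} (S.perm_mem _)
    have h2 := hE {f.1 x} (S.perm_mem _)
    simp only [perm_singleton] at this h2
    change act f (E _) = E _
    rw [this, h2, hact, Multiset.map_singleton]

end YBSolution

/-! ### Fixed points of maps of prime power order, and torsion counts. -/

/-- For a map `f` of a finite set `s` into itself with `f ^ (p ^ k) = 1` on `s`, the number of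
fixed points is congruent to the number of points modulo `p`. -/
theorem Set.MapsTo.ncard_modEq_ncard_fixedPoints {α : Type*} {s : Set α} (hs : s.Finite)
    {f : α → α} (hf : Set.MapsTo f s s) {p k : ℕ} (hp : p.Prime)
    (hfk : ∀ x ∈ s, f^[p ^ k] x = x) :
    s.ncard ≡ (s ∩ Function.fixedPoints f).ncard [MOD p] := by
  classical
  have : Fact p.Prime := ⟨hp⟩
  have := hs.fintype
  let F : Function.End s := hf.restrict f s s
  have hF : F ^ p ^ k = 1 := by
    funext x
    have h : (F^[p ^ k] x : α) = f^[p ^ k] x := hf.coe_iterate_restrict x (p ^ k)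
    have h' : F ^ p ^ k = F^[p ^ k] := by
      generalize p ^ k = m
      induction m with
      | zero => rfl
      | succ m ih => rw [pow_succ, ih, Function.iterate_succ]; rfl
    rw [h']
    exact Subtype.ext (h.trans (hfk x x.2))
  have h := Equiv.Perm.card_fixedPoints_modEq hF
  have h2 : (s ∩ Function.fixedPoints f).ncard = Nat.card (Function.fixedPoints F) := by
    rw [← Nat.card_coe_set_eq]
    refine Nat.card_congr ⟨fun x => ⟨⟨x, x.2.1⟩, Subtype.ext x.2.2⟩,
      fun x => ⟨x.1, x.1.2, congrArg Subtype.val x.2⟩, fun _ => rfl, fun _ => rfl⟩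
  rwa [h2, Nat.card_eq_fintype_card, ← Nat.card_coe_set_eq, Nat.card_eq_fintype_card]

/-- The number of points that are not fixed is a multiple of `p` and, one point being fixed, is less
than `p`; so it is zero. -/
theorem Set.MapsTo.eq_self_of_ncard_le {α : Type*} {s : Set α} (hs : s.Finite)
    {f : α → α} (hf : Set.MapsTo f s s) {p k : ℕ} (hp : p.Prime)
    (hfk : ∀ x ∈ s, f^[p ^ k] x = x) (hcard : s.ncard ≤ p) {y : α} (hy : y ∈ s) (hfy : f y = y) :
    ∀ x ∈ s, f x = x := by
  have h := hf.ncard_modEq_ncard_fixedPoints hs hp hfk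
  have hle : (s ∩ Function.fixedPoints f).ncard ≤ s.ncard :=
    Set.ncard_le_ncard Set.inter_subset_left hs
  have hpos : 0 < (s ∩ Function.fixedPoints f).ncard :=
    (Set.ncard_pos (hs.subset Set.inter_subset_left)).2 ⟨y, hy, hfy⟩
  have heq : s.ncard = (s ∩ Function.fixedPoints f).ncard := by
    obtain ⟨d, hd⟩ := (Nat.modEq_iff_dvd' hle).1 h.symm
    rcases Nat.eq_zero_or_pos d with rfl | hd0
    · lia
    · have := Nat.le_mul_of_pos_right p hd0
      lia
  have := Set.eq_of_subset_of_ncard_le (Set.inter_subset_left (s := s)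
    (t := Function.fixedPoints f)) heq.le hs
  intro x hx
  rw [← this] at hx
  exact hx.2

/-- If an automorphism `f` of `p`-power order of a group `B` of order `p²`, `p` odd, has
`∑ i < p, f ^ i t ≠ 0`, then `p • t ≠ 0`. -/
theorem nsmul_ne_zero_of_sum_pow_ne_zero {B : Type*} [AddCommGroup B] {p k : ℕ} (hp : p.Prime)
    (hodd : Odd p) (hB : Nat.card B = p ^ 2) (f : AddMonoid.End B) (hf : f ^ p ^ k = 1) {t : B}
    (ht : ∑ i ∈ Finset.range p, (f ^ i) t ≠ 0) : p • t ≠ 0 := by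
  have hfin : Finite B := Nat.finite_of_card_ne_zero (hB ▸ pow_ne_zero _ hp.ne_zero)
  have hit : ∀ x, f^[p ^ k] x = x := by
    intro x
    rw [← AddMonoid.End.coe_pow, hf]
    rfl
  let M : B →+ B := (f - 1 : AddMonoid.End B)
  have hM : ∀ x, M x = f x - x := fun _ => rfl
  -- The number of fixed points of `f` is divisible by `p`, so `0` is not the only one. Hence the
  -- image of `f - 1` has order dividing `p`, and `f` acts trivially on it.
  have hker : M.ker ≠ ⊥ := by
    intro hbot
    have h := (Set.mapsTo_univ (f : B → B) Set.univ).ncard_modEq_ncard_fixedPoints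
      Set.finite_univ hp (fun x _ => hit x)
    have h1 : Set.univ ∩ Function.fixedPoints f = {0} := by
      ext x
      have : x ∈ M.ker ↔ x ∈ (⊥ : AddSubgroup B) := by rw [hbot]
      rw [AddMonoidHom.mem_ker, hM, sub_eq_zero, AddSubgroup.mem_bot] at this
      simpa [Function.mem_fixedPoints, Function.IsFixedPt] using this
    rw [h1, Set.ncard_univ, hB, Set.ncard_singleton] at h
    have h2 : p ∣ 1 := (h.dvd_iff dvd_rfl).1 (dvd_pow_self p two_ne_zero)
    exact hp.one_lt.ne' (Nat.dvd_one.1 h2)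
  have hcard : Nat.card M.ker * Nat.card M.range = p ^ 2 := by
    rw [← AddSubgroup.index_ker, AddSubgroup.card_mul_index, hB]
  have hrange : Nat.card M.range ∣ p := by
    obtain ⟨j, hj, hj'⟩ := (Nat.dvd_prime_pow hp).1 (Dvd.intro_left _ hcard)
    rw [hj']
    have : j ≠ 2 := by
      rintro rfl
      rw [hj'] at hcard
      have := Nat.eq_of_mul_eq_mul_right (pow_pos hp.pos 2) (hcard.trans (one_mul _).symm)
      exact hker (AddSubgroup.card_eq_one.1 this)
    exact (pow_dvd_pow p (show j ≤ 1 by lia)).trans (pow_one p).dvd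
  have hfix : ∀ x, f (M x) = M x := by
    intro x
    have hmaps : Set.MapsTo f (M.range : Set B) (M.range : Set B) := by
      rintro _ ⟨y, rfl⟩
      exact ⟨f y, by rw [hM, hM, map_sub]⟩
    refine hmaps.eq_self_of_ncard_le (Set.toFinite _) hp (fun x _ => hit x) ?_
      (zero_mem M.range) (map_zero f) _ ⟨x, rfl⟩
    exact Nat.le_of_dvd hp.pos hrange
  -- As `f` fixes `M t`, the sum is `p • t + (p * (p - 1) / 2) • M t`. For odd `p` the second
  -- coefficient is a multiple of `p`, so `p • t = 0` would make the sum vanish.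
  have hpow : ∀ i : ℕ, (f ^ i) t = t + i • M t := by
    intro i
    induction i with
    | zero => simp
    | succ i ih =>
      have h : (f ^ (i + 1)) t = f ((f ^ i) t) := by rw [pow_succ']; rfl
      rw [h, ih, map_add, map_nsmul, hfix, hM, succ_nsmul]
      abel
  intro hpt
  apply ht
  have hpM : p • M t = 0 := by rw [← map_nsmul, hpt, map_zero]
  simp only [hpow, Finset.sum_add_distrib, Finset.sum_const, Finset.card_range, hpt, zero_add]
  rw [← Finset.sum_smul]
  obtain ⟨m, rfl⟩ := hodd
  have : ∑ i ∈ Finset.range (2 * m + 1), i = m * (2 * m + 1) := by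
    have h := Finset.sum_range_id_mul_two (2 * m + 1)
    have h2 : (2 * m + 1) * (2 * m + 1 - 1) = (m * (2 * m + 1)) * 2 := by
      rw [Nat.add_sub_cancel]; ring
    exact Nat.eq_of_mul_eq_mul_right two_pos (h.trans h2)
  rw [this, mul_smul, hpM, smul_zero]

/-- In an abelian group of order `m * n`, with `m` and `n` coprime, there are `m` elements killed
by `m`. -/
theorem AddCommGroup.card_ker_nsmul {A : Type*} [AddCommGroup A] {m n : ℕ} (hmn : m.Coprime n)
    (hm : m ≠ 0) (hn : n ≠ 0) (hA : Nat.card A = m * n) :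
    Nat.card (nsmulAddMonoidHom (α := A) m).ker = m := by
  have hfin : Finite A := Nat.finite_of_card_ne_zero (hA ▸ mul_ne_zero hm hn)
  -- By Cauchy's theorem a prime dividing the order of the `a`-torsion divides `a`.
  have hcop : ∀ {a b : ℕ}, a.Coprime b →
      (Nat.card (nsmulAddMonoidHom (α := A) a).ker).Coprime b := by
    intro a b hab
    refine Nat.coprime_of_dvd fun l hl h1 h2 => ?_
    have : Fact l.Prime := ⟨hl⟩
    obtain ⟨x, hx⟩ := exists_prime_addOrderOf_dvd_card' l h1
    have h3 : l ∣ a := by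
      rw [← hx]
      exact addOrderOf_dvd_of_nsmul_eq_zero (Subtype.ext x.2)
    exact hl.one_lt.ne' (Nat.dvd_one.1 (hab ▸ Nat.dvd_gcd h3 h2))
  have h1 : Nat.card (nsmulAddMonoidHom (α := A) m).ker ∣ m :=
    (hcop hmn).dvd_of_dvd_mul_right (hA ▸ AddSubgroup.card_addSubgroup_dvd_card _)
  have h2 : (nsmulAddMonoidHom (α := A) n).range ≤ (nsmulAddMonoidHom (α := A) m).ker := by
    rintro _ ⟨x, rfl⟩
    change m • n • x = 0
    rw [← mul_smul, ← hA]
    exact card_nsmul_eq_zero'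
  have h3 : Nat.card (nsmulAddMonoidHom (α := A) n).ker ∣ n :=
    (hcop hmn.symm).dvd_of_dvd_mul_left (hA ▸ AddSubgroup.card_addSubgroup_dvd_card _)
  have h4 : Nat.card (nsmulAddMonoidHom (α := A) n).ker *
      Nat.card (nsmulAddMonoidHom (α := A) n).range = m * n := by
    rw [← AddSubgroup.index_ker, AddSubgroup.card_mul_index, hA]
  have h5 := Nat.le_of_dvd (Nat.pos_of_ne_zero hm) h1
  have h6 := Nat.le_of_dvd (Nat.pos_of_ne_zero hn) h3
  have h7 := AddSubgroup.card_le_of_le h2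
  refine le_antisymm h5 (le_of_mul_le_mul_right (a := n) ?_ (Nat.pos_of_ne_zero hn))
  rw [← h4, mul_comm]
  exact Nat.mul_le_mul h7 h6

/-! ### Braces with multiplicative group `ℤ/p² ⋊ ℤ/q`. -/

namespace BijectiveCocycle

section General

variable {G H A : Type*} [Group G] [Group H] [AddCommGroup A] (c : BijectiveCocycle G A)

/-- Transport of a cocycle along an isomorphism of groups. -/
def comp (e : H ≃* G) : BijectiveCocycle H A where
  toEquiv := e.toEquiv.trans c.toEquiv
  act := c.act.comp e.toMonoidHom
  map_mul x y := by simp [c.map_mul]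

theorem act_mul_apply (x y : G) (a : A) : c.act (x * y) a = c.act x (c.act y a) := by
  rw [MonoidHom.map_mul]; rfl

theorem act_one_apply (a : A) : c.act 1 a = a := by rw [map_one]; rfl

theorem act_inv_apply_eq {x : G} {a b : A} : c.act x⁻¹ a = b ↔ a = c.act x b := by
  constructor
  · rintro rfl
    rw [← act_mul_apply, mul_inv_cancel, act_one_apply]
  · rintro rfl
    rw [← act_mul_apply, inv_mul_cancel, act_one_apply]

theorem iterate_act (x : G) (k : ℕ) (a : A) : (c.act x)^[k] a = c.act (x ^ k) a := by
  rw [← AddMonoid.End.coe_pow, map_pow]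

theorem act_pow_of_eq {x : G} {a : A} (h : c.act x a = a) (k : ℕ) : c.act (x ^ k) a = a := by
  rw [← iterate_act]
  exact Function.iterate_fixed h k

theorem toEquiv_one : c.toEquiv 1 = 0 := by
  have h := c.map_mul 1 1
  rwa [mul_one, act_one_apply, left_eq_add] at h

theorem toEquiv_inv (x : G) : c.toEquiv x⁻¹ = -c.act x⁻¹ (c.toEquiv x) := by
  have h := c.map_mul x⁻¹ x
  rw [inv_mul_cancel, toEquiv_one] at h
  exact eq_neg_of_add_eq_zero_left h.symm

theorem toEquiv_pow (x : G) (k : ℕ) :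
    c.toEquiv (x ^ k) = ∑ i ∈ Finset.range k, c.act (x ^ i) (c.toEquiv x) := by
  induction k with
  | zero => simp [toEquiv_one]
  | succ k ih => rw [pow_succ, c.map_mul, ih, Finset.sum_range_succ]

/-- The subgroup of `G` corresponding to the elements of `A` killed by `m`. -/
def torsion (m : ℕ) : Subgroup G where
  carrier := {x | m • c.toEquiv x = 0}
  one_mem' := by simp [toEquiv_one]
  mul_mem' {x y} hx hy := by
    simp only [Set.mem_ofPred_eq] at *
    rw [c.map_mul, smul_add, hx, zero_add, ← map_nsmul, hy, map_zero]
  inv_mem' {x} hx := by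
    simp only [Set.mem_ofPred_eq] at *
    rw [toEquiv_inv, smul_neg, ← map_nsmul, hx, map_zero, neg_zero]

theorem mem_torsion {m : ℕ} {x : G} : x ∈ c.torsion m ↔ m • c.toEquiv x = 0 := Iff.rfl

theorem card_torsion (m : ℕ) :
    Nat.card (c.torsion m) = Nat.card (nsmulAddMonoidHom (α := A) m).ker :=
  Nat.card_congr (c.toEquiv.subtypeEquiv fun _ => Iff.rfl)

/-- The action of `G` on the elements of `A` killed by `m`. -/
def actKer (m : ℕ) : G →* AddMonoid.End (nsmulAddMonoidHom (α := A) m).ker where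
  toFun x := ((c.act x : A →+ A).comp (nsmulAddMonoidHom (α := A) m).ker.subtype).codRestrict _
    fun a => by
      have h : m • (a : A) = 0 := a.2
      change m • c.act x (a : A) = 0
      rw [← map_nsmul, h, map_zero]
  map_one' := by
    ext a
    exact c.act_one_apply a
  map_mul' x y := by
    ext a
    exact c.act_mul_apply x y a

theorem coe_actKer (m : ℕ) (x : G) (a : (nsmulAddMonoidHom (α := A) m).ker) :
    (c.actKer m x a : A) = c.act x a := rfl

end General

section Semidirect

open CyclicSemidirect

variable {p q : ℕ} {g : (ZMod (p ^ 2))ˣ} {hg : orderOf g = q} {A : Type*} [AddCommGroup A]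
  (c : BijectiveCocycle (CyclicSemidirect (p ^ 2) q g hg) A)

theorem card_semidirect
    (c : BijectiveCocycle (CyclicSemidirect (p ^ 2) q g hg) A)
    (hp : p.Prime) (hq : q.Prime) :
    Nat.card A = p ^ 2 * q := by
  have := NeZero.mk hq.ne_zero
  have := NeZero.mk (pow_ne_zero 2 hp.ne_zero)
  rw [← Nat.card_congr c.toEquiv, card_eq]

theorem card_ker_nsmul_sq
    (c : BijectiveCocycle (CyclicSemidirect (p ^ 2) q g hg) A)
    (hp : p.Prime) (hq : q.Prime) (hpq : p.Coprime q) :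
    Nat.card (nsmulAddMonoidHom (α := A) (p ^ 2)).ker = p ^ 2 :=
  AddCommGroup.card_ker_nsmul (hpq.pow_left 2) (pow_ne_zero 2 hp.ne_zero) hq.ne_zero
    (c.card_semidirect hp hq)

theorem card_ker_nsmul_right
    (c : BijectiveCocycle (CyclicSemidirect (p ^ 2) q g hg) A)
    (hp : p.Prime) (hq : q.Prime) (hpq : p.Coprime q) :
    Nat.card (nsmulAddMonoidHom (α := A) q).ker = q :=
  AddCommGroup.card_ker_nsmul (hpq.pow_left 2).symm hq.ne_zero (pow_ne_zero 2 hp.ne_zero)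
    ((c.card_semidirect hp hq).trans (mul_comm _ _))

/-- The torsion subgroup has order `p²`, which is invertible modulo `q`, so it projects trivially to
`ℤ/q`; the orders then force equality. -/
theorem mem_torsion_iff (hp : p.Prime) (hq : q.Prime) (hpq : p.Coprime q)
    (x : CyclicSemidirect (p ^ 2) q g hg) : x ∈ c.torsion (p ^ 2) ↔ ∃ a, x = el a 0 := by
  have := NeZero.mk hq.ne_zero
  have := NeZero.mk (pow_ne_zero 2 hp.ne_zero)
  have hcard : Nat.card (c.torsion (p ^ 2)) = p ^ 2 := by
    rw [c.card_torsion, c.card_ker_nsmul_sq hp hq hpq]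
  have hinj : Function.Injective
      fun a : ZMod (p ^ 2) => (el a 0 : CyclicSemidirect (p ^ 2) q g hg) :=
    fun a b h => (el_inj.1 h).1
  have hsub : (c.torsion (p ^ 2) : Set _) ⊆
      Set.range fun a : ZMod (p ^ 2) => (el a 0 : CyclicSemidirect (p ^ 2) q g hg) := by
    intro x hx
    obtain ⟨a, i, rfl⟩ := exists_el x
    have h1 : (el a i : CyclicSemidirect (p ^ 2) q g hg) ^ p ^ 2 = 1 := by
      have := pow_card_eq_one' (x := (⟨el a i, hx⟩ : c.torsion (p ^ 2)))
      rw [hcard] at this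
      exact congrArg Subtype.val this
    obtain ⟨b, hb⟩ := right_pow (hg := hg) a i (p ^ 2)
    rw [h1, ← el_zero, el_inj] at hb
    have hu : IsUnit ((p ^ 2 : ℕ) : ZMod q) :=
      (ZMod.isUnit_iff_coprime _ _).2 (hpq.pow_left 2)
    exact ⟨a, el_inj.2 ⟨rfl, (hu.mul_right_eq_zero.1 hb.2.symm).symm⟩⟩
  have heq := Set.eq_of_subset_of_ncard_le hsub (by
    rw [← Set.image_univ, Set.ncard_image_of_injective _ hinj, Set.ncard_univ, Nat.card_zmod]
    exact hcard.ge)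
  rw [← SetLike.mem_coe, heq]
  exact ⟨fun ⟨a, h⟩ => ⟨a, h.symm⟩, fun ⟨a, h⟩ => ⟨a, h.symm⟩⟩

/-- Split `c (0, 1) = u + v` into its `p²`-torsion and `q`-torsion parts, with `u = c (a, 0)`. Then
`(a, 0)⁻¹ * (0, 1)` has its value in the `q`-torsion. It is `(-a, 1)`, a conjugate of `(0, 1)`
because `g - 1` is a unit. -/
theorem exists_conj_mem_torsion (hp : p.Prime) (hq : q.Prime) (hpq : p.Coprime q) :
    ∃ m, MulAut.conj (el m 0) (el 0 1) ∈ c.torsion q := by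
  set y := c.toEquiv (el 0 1) with hy
  have hcard : (p ^ 2 * q) • y = 0 := by
    rw [← c.card_semidirect hp hq]
    exact card_nsmul_eq_zero'
  obtain ⟨u, v, hu, hv, huv⟩ : ∃ u v : A, p ^ 2 • u = 0 ∧ q • v = 0 ∧ u + v = y := by
    obtain ⟨r, s, hrs⟩ := Nat.isCoprime_iff_coprime.2 (hpq.pow_left 2)
    refine ⟨s • q • y, r • p ^ 2 • y, ?_, ?_, ?_⟩
    · rw [smul_comm, ← mul_smul, hcard, smul_zero]
    · rw [smul_comm, ← mul_smul, mul_comm, hcard, smul_zero]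
    · rw [← natCast_zsmul y q, ← natCast_zsmul y (p ^ 2), ← mul_smul, ← mul_smul, ← add_smul,
        add_comm, hrs, one_smul]
  obtain ⟨x, rfl⟩ := c.toEquiv.surjective u
  obtain ⟨a, rfl⟩ := (c.mem_torsion_iff hp hq hpq x).1 hu
  obtain ⟨m, hm⟩ : ∃ m, ((g : ZMod (p ^ 2)) - 1) * m = a := by
    obtain ⟨w, hw⟩ := isUnit_sub_one_of_orderOf hp hq.one_lt.ne' hpq hg
    exact ⟨↑w⁻¹ * a, by rw [← hw, Units.mul_inv_cancel_left]⟩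
  refine ⟨m, ?_⟩
  have h1 : MulAut.conj (el m 0) (el 0 1) =
      ((el a 0)⁻¹ * el 0 1 : CyclicSemidirect (p ^ 2) q g hg) := by
    rw [MulAut.conj_apply, mul_inv_eq_iff_eq_mul, el_inv, el_mul, el_mul, el_mul, el_inj, ← hm]
    simp only [scalar_zero, scalar_one hg, neg_zero, zero_add]
    constructor <;> ring
  have h2 := c.map_mul (el a 0) ((el a 0)⁻¹ * el 0 1)
  rw [mul_inv_cancel_left, ← hy, ← huv, add_right_inj] at h2
  rw [h1, mem_torsion, ← c.act_inv_apply_eq.2 h2, ← map_nsmul, hv, map_zero]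

/-- The `q`-torsion has `q < p` elements and `0` is fixed. So both `(a, 0)`, of `p`-power order, and
`(0, 1)`, of order `q`, act trivially on it by counting fixed points. -/
theorem act_eq_of_nsmul_eq_zero (hp : p.Prime) (hq : q.Prime) (hqp : q < p)
    (x : CyclicSemidirect (p ^ 2) q g hg) {y : A} (hy : q • y = 0) :
    c.act x y = y := by
  have := NeZero.mk hq.ne_zero
  have hpq : p.Coprime q := (Nat.coprime_primes hp hq).2 hqp.ne'
  have : Finite A := Nat.finite_of_card_ne_zero (by
    rw [c.card_semidirect hp hq]
    exact mul_ne_zero (pow_ne_zero 2 hp.ne_zero) hq.ne_zero)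
  have hmaps : ∀ x, Set.MapsTo (c.act x) {y : A | q • y = 0} {y : A | q • y = 0} := by
    intro x y hy
    rw [Set.mem_ofPred_eq] at *
    rw [← map_nsmul, hy, map_zero]
  have hncard : {y : A | q • y = 0}.ncard = q := c.card_ker_nsmul_right hp hq hpq
  obtain ⟨a, i, rfl⟩ := exists_el x
  have hai : (el a i : CyclicSemidirect (p ^ 2) q g hg) = el a 0 * el 0 1 ^ i.val := by
    rw [el_zero_pow, el_mul, el_inj]
    simp [scalar_zero]
  rw [hai, act_mul_apply, c.act_pow_of_eq]
  · refine (hmaps (el a 0)).eq_self_of_ncard_le (Set.toFinite _) hp (k := 2) (fun z _ => ?_)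
      (hncard.le.trans hqp.le) (by simp : (0 : A) ∈ {y : A | q • y = 0}) (map_zero _) y hy
    rw [iterate_act, el_pow, ZMod.natCast_self, zero_mul, el_zero, act_one_apply]
  · refine (hmaps (el 0 1)).eq_self_of_ncard_le (Set.toFinite _) hq (k := 1) (fun z _ => ?_)
      hncard.le (by simp : (0 : A) ∈ {y : A | q • y = 0}) (map_zero _) y hy
    rw [iterate_act, pow_one, el_zero_pow, ZMod.natCast_self, zero_mul, el_zero, act_one_apply]

theorem el_zero_mem_torsion [NeZero q] (hb : el 0 1 ∈ c.torsion q) (i : ZMod q) :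
    el 0 i ∈ c.torsion q := by
  have := pow_mem hb i.val
  rwa [el_zero_pow, ZMod.natCast_zmod_val, mul_one] at this

/-- Compare the cocycle on the two sides of `(0, i) * (a, 0) = (g ^ i * a, 0) * (0, i)`, using that
the value at `(0, i)` is fixed by `G`. -/
theorem act_el_zero (hp : p.Prime) (hq : q.Prime) (hqp : q < p)
    (hb : el 0 1 ∈ c.torsion q) (i : ZMod q) (a : ZMod (p ^ 2)) :
    c.act (el 0 i) (c.toEquiv (el a 0)) = c.toEquiv (el (scalar g i * a) 0) := by
  have := NeZero.mk hq.ne_zero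
  have h1 := c.map_mul (el 0 i) (el a 0)
  have h2 := c.map_mul (el (scalar g i * a) 0) (el 0 i)
  rw [c.act_eq_of_nsmul_eq_zero hp hq hqp _ (c.el_zero_mem_torsion hb i), el_mul] at h2
  rw [el_mul] at h1
  simp only [zero_add, add_zero, mul_zero] at h1 h2
  rw [h1, add_comm] at h2
  exact add_right_cancel h2

/-- The `p²`-torsion is cyclic, generated by `t = c (1, 0)`. Indeed `c ((1, 0) ^ p)` is the sum of
the first `p` translates of `t` under `(1, 0)`, and it is nonzero since `(1, 0) ^ p ≠ 1`; hence `p •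
t ≠ 0`. -/
theorem exists_nsmul_eq (hp : p.Prime) (hodd : Odd p) (hq : q.Prime) (hpq : p.Coprime q)
    {y : A} (hy : p ^ 2 • y = 0) : ∃ k : ℕ, y = k • c.toEquiv (el 1 0) := by
  set t := c.toEquiv (el 1 0) with ht
  have htp : p ^ 2 • t = 0 := (c.mem_torsion_iff hp hq hpq _).2 ⟨1, rfl⟩
  have hcard := c.card_ker_nsmul_sq hp hq hpq
  have hfin := Nat.finite_of_card_ne_zero (hcard ▸ pow_ne_zero 2 hp.ne_zero)
  let T : (nsmulAddMonoidHom (α := A) (p ^ 2)).ker := ⟨t, htp⟩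
  have hT : p • T ≠ 0 := by
    refine nsmul_ne_zero_of_sum_pow_ne_zero hp hodd hcard (c.actKer (p ^ 2) (el 1 0)) (k := 2)
      ?_ ?_
    · rw [← map_pow, el_pow, ZMod.natCast_self, zero_mul, el_zero, map_one]
    · intro h
      have h1 := congrArg (Subtype.val) h
      simp only [← map_pow, AddSubgroup.val_finsetSum, coe_actKer] at h1
      change ∑ i ∈ Finset.range p, c.act (el 1 0 ^ i) t = 0 at h1
      rw [ht, ← c.toEquiv_pow, ← c.toEquiv_one, c.toEquiv.apply_eq_iff_eq, el_pow, ← el_zero,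
        el_inj, mul_one] at h1
      have h2 := (ZMod.natCast_eq_zero_iff p (p ^ 2)).1 h1.1
      have h3 := Nat.le_of_dvd hp.pos h2
      have := hp.two_le
      nlinarith
  have : Fact p.Prime := ⟨hp⟩
  have hord : addOrderOf T = p ^ 2 :=
    addOrderOf_eq_prime_pow (n := 1) (by rwa [pow_one]) (Subtype.ext htp)
  have htop : AddSubgroup.zmultiples T = ⊤ := by
    rw [← AddSubgroup.card_eq_iff_eq_top, Nat.card_zmultiples, hord, hcard]
  have hmem : (⟨y, hy⟩ : (nsmulAddMonoidHom (α := A) (p ^ 2)).ker) ∈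
      AddSubgroup.zmultiples T := htop ▸ AddSubgroup.mem_top _
  obtain ⟨k, hk⟩ := (mem_multiples_iff_mem_zmultiples (x := T)).2 hmem
  exact ⟨k, (congrArg Subtype.val hk).symm⟩

/-- Endomorphisms of a cyclic group commute, so commutators of `G` act trivially on the
`p²`-torsion. One of them is `(g - 1, 0)`, which generates `ℤ/p²` because `g - 1` is a unit. -/
theorem act_el_left (hp : p.Prime) (hodd : Odd p) (hq : q.Prime) (hqp : q < p)
    (a : ZMod (p ^ 2)) {y : A} (hy : p ^ 2 • y = 0) :
    c.act (el a 0) y = y := by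
  have := NeZero.mk (pow_ne_zero 2 hp.ne_zero)
  have hpq : p.Coprime q := (Nat.coprime_primes hp hq).2 hqp.ne'
  have hmaps : ∀ x {y : A}, p ^ 2 • y = 0 → p ^ 2 • c.act x y = 0 := by
    intro x y hy
    rw [← map_nsmul, hy, map_zero]
  have hcomm : ∀ x x' {y : A}, p ^ 2 • y = 0 → c.act x (c.act x' y) = c.act x' (c.act x y) := by
    intro x x' y hy
    have htp : p ^ 2 • c.toEquiv (el 1 0) = 0 := (c.mem_torsion_iff hp hq hpq _).2 ⟨1, rfl⟩
    obtain ⟨k, rfl⟩ := c.exists_nsmul_eq hp hodd hq hpq hy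
    obtain ⟨l, hl⟩ := c.exists_nsmul_eq hp hodd hq hpq (hmaps x htp)
    obtain ⟨m, hm⟩ := c.exists_nsmul_eq hp hodd hq hpq (hmaps x' htp)
    simp only [map_nsmul, hl, hm]
    rw [smul_comm l m]
  have h1 : c.act (el ((g : ZMod (p ^ 2)) - 1) 0) y = y := by
    have h : (el ((g : ZMod (p ^ 2)) - 1) 0 : CyclicSemidirect (p ^ 2) q g hg) =
        (el 1 0)⁻¹ * (el 0 1 * el 1 0 * (el 0 1)⁻¹) := by
      rw [eq_inv_mul_iff_mul_eq, el_conj, el_mul, el_inj, scalar_one hg, scalar_zero]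
      simp
    rw [h, act_mul_apply, act_mul_apply, act_mul_apply, act_inv_apply_eq,
      hcomm _ _ (hmaps _ hy), ← c.act_mul_apply (el 0 1), mul_inv_cancel, act_one_apply]
  obtain ⟨w, hw⟩ := isUnit_sub_one_of_orderOf hp hq.one_lt.ne' hpq hg
  have h2 : (el a 0 : CyclicSemidirect (p ^ 2) q g hg) =
      el ((g : ZMod (p ^ 2)) - 1) 0 ^ (↑w⁻¹ * a).val := by
    rw [el_pow, el_inj, ZMod.natCast_zmod_val, ← hw, mul_comm, Units.mul_inv_cancel_left]
    exact ⟨rfl, rfl⟩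
  rw [h2]
  exact c.act_pow_of_eq h1 _

theorem act_toEquiv_of_mem_torsion (hp : p.Prime) (hodd : Odd p) (hq : q.Prime) (hqp : q < p)
    (hb : el 0 1 ∈ c.torsion q) (a b : ZMod (p ^ 2)) (i j : ZMod q) :
    c.act (el a i) (c.toEquiv (el b j)) = c.toEquiv (el (scalar g i * b) j) := by
  have := NeZero.mk hq.ne_zero
  have hpq : p.Coprime q := (Nat.coprime_primes hp hq).2 hqp.ne'
  have hj := c.el_zero_mem_torsion hb j
  have key : ∀ b, c.toEquiv (el b j) = c.toEquiv (el b 0) + c.toEquiv (el 0 j) := by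
    intro b
    have h := c.map_mul (el b 0) (el 0 j)
    rw [c.act_eq_of_nsmul_eq_zero hp hq hqp _ hj, el_mul] at h
    simpa using h
  have hai : (el a i : CyclicSemidirect (p ^ 2) q g hg) = el a 0 * el 0 i := by
    rw [el_mul, el_inj]
    simp
  rw [key b, key (scalar g i * b), map_add, c.act_eq_of_nsmul_eq_zero hp hq hqp _ hj, hai,
    act_mul_apply,
    c.act_el_zero hp hq hqp hb, c.act_el_left hp hodd hq hqp]
  exact (c.mem_torsion_iff hp hq hpq _).2 ⟨_, rfl⟩

/-- Up to an automorphism of the group, the only brace structure on `ℤ/p² ⋊ ℤ/q` is the one whose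
additive group is the direct product. -/
theorem exists_mulAut (hp : p.Prime) (hodd : Odd p) (hq : q.Prime) (hqp : q < p) :
    ∃ θ : MulAut (CyclicSemidirect (p ^ 2) q g hg), ∀ a b i j,
      c.act (θ (el a i)) (c.toEquiv (θ (el b j))) = c.toEquiv (θ (el (scalar g i * b) j)) := by
  obtain ⟨m, hm⟩ := c.exists_conj_mem_torsion hp hq ((Nat.coprime_primes hp hq).2 hqp.ne')
  exact ⟨MulAut.conj (el m 0),
    (c.comp (MulAut.conj (el m 0))).act_toEquiv_of_mem_torsion hp hodd hq hqp hm⟩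

end Semidirect

end BijectiveCocycle

/-! ### Generators, automorphisms and subgroups of the semidirect product. -/

namespace CyclicSemidirect

variable {n q : ℕ} {g : (ZMod n)ˣ} {hg : orderOf g = q}

theorem el_eq_pow [NeZero n] {u : ZMod n} (hu : IsUnit u) (a : ZMod n) :
    ∃ k : ℕ, (el a 0 : CyclicSemidirect n q g hg) = el u 0 ^ k := by
  obtain ⟨w, rfl⟩ := hu
  refine ⟨(↑w⁻¹ * a).val, ?_⟩
  rw [el_pow, el_inj, ZMod.natCast_zmod_val, mul_comm, Units.mul_inv_cancel_left]
  exact ⟨rfl, rfl⟩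

/-- The generators for `i = 1` and `i = 0` differ by `(g - 1, 0)`, which generates `ℤ/n`. Removing
the first coordinate leaves `(0, j)`, which generates `ℤ/q`. -/
theorem closure_range_eq_top [NeZero n] (hq : q.Prime) (hu : IsUnit ((g : ZMod n) - 1))
    {j : ZMod q} (hj : j ≠ 0) :
    Subgroup.closure (Set.range fun i : ZMod q =>
      (el (scalar g i) j : CyclicSemidirect n q g hg)) = ⊤ := by
  have : Fact q.Prime := ⟨hq⟩
  set K := Subgroup.closure (Set.range fun i : ZMod q =>
      (el (scalar g i) j : CyclicSemidirect n q g hg)) with hK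
  have h0 : (el 1 j : CyclicSemidirect n q g hg) ∈ K :=
    Subgroup.subset_closure ⟨0, by simp only [scalar_zero]⟩
  have h1 : (el g j : CyclicSemidirect n q g hg) ∈ K :=
    Subgroup.subset_closure ⟨1, by simp only [scalar_one hg]⟩
  have h2 : (el ((g : ZMod n) - 1) 0 : CyclicSemidirect n q g hg) ∈ K := by
    have : (el ((g : ZMod n) - 1) 0 : CyclicSemidirect n q g hg) = el g j * (el 1 j)⁻¹ := by
      rw [eq_mul_inv_iff_mul_eq, el_mul, el_inj, scalar_zero]
      simp
    rw [this]
    exact mul_mem h1 (inv_mem h0)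
  have h3 : ∀ a, (el a 0 : CyclicSemidirect n q g hg) ∈ K := by
    intro a
    obtain ⟨k, hk⟩ := el_eq_pow (hg := hg) hu a
    exact hk ▸ pow_mem h2 k
  have h4 : ∀ i, (el 0 i : CyclicSemidirect n q g hg) ∈ K := by
    intro i
    have h : (el 0 j : CyclicSemidirect n q g hg) = el (-1) 0 * el 1 j := by
      rw [el_mul, el_inj, scalar_zero]
      simp
    have h5 : (el 0 i : CyclicSemidirect n q g hg) = el 0 j ^ (i * j⁻¹).val := by
      rw [el_zero_pow, ZMod.natCast_zmod_val, inv_mul_cancel_right₀ hj]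
    rw [h5, h]
    exact pow_mem (mul_mem (h3 _) h0) _
  rw [eq_top_iff]
  intro x _
  obtain ⟨a, i, rfl⟩ := exists_el x
  have : (el a i : CyclicSemidirect n q g hg) = el a 0 * el 0 i := by
    rw [el_mul, el_inj]
    simp
  rw [this]
  exact mul_mem (h3 a) (h4 i)

/-- Automorphisms of the semidirect product act trivially on the quotient `ℤ/q`. -/
theorem exists_mulEquiv_el [NeZero n] (hnq : n.Coprime q)
    (ψ : CyclicSemidirect n q g hg ≃* CyclicSemidirect n q g hg) (a : ZMod n) (i : ZMod q) :
    ∃ b, ψ (el a i) = el b i := by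
  have h0 : ∃ v, ψ (el 1 0) = el v 0 := by
    obtain ⟨v, j, hv⟩ := exists_el (ψ (el 1 0))
    refine ⟨v, hv.trans (el_inj.2 ⟨rfl, ?_⟩)⟩
    obtain ⟨b, hb⟩ := right_pow (hg := hg) v j n
    rw [← hv, ← map_pow, el_pow, ZMod.natCast_self, zero_mul, el_zero, map_one, ← el_zero,
      el_inj] at hb
    exact ((ZMod.isUnit_iff_coprime n q).2 hnq).mul_right_eq_zero.1 hb.2.symm
  obtain ⟨v, hv⟩ := h0
  have h1 : ∀ b, ψ (el b 0) = el (b * v) 0 := by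
    intro b
    have : (el b 0 : CyclicSemidirect n q g hg) = el 1 0 ^ b.val := by
      rw [el_pow, ZMod.natCast_zmod_val, mul_one]
    rw [this, map_pow, hv, el_pow, ZMod.natCast_zmod_val]
  obtain ⟨b, j, hb⟩ := exists_el (ψ (el a i))
  refine ⟨b, hb.trans (el_inj.2 ⟨rfl, ?_⟩)⟩
  -- The second coordinate is recovered from conjugation on `ℤ/n`, which is multiplication by `g ^
  -- i`; `ψ` preserves `ℤ/n` and this scalar.
  have h2 := congrArg ψ (el_conj (hg := hg) a 1 i)
  rw [map_mul, map_mul, map_inv, hb, hv, el_conj, h1, el_inj, mul_one] at h2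
  have h3 : ψ (el (scalar g j - scalar g i) 0) = ψ 1 := by
    rw [h1, sub_mul, h2.1, sub_self, map_one, el_zero]
  have h4 := ψ.injective h3
  rw [← el_zero, el_inj, sub_eq_zero] at h4
  exact scalar_injective hg h4.1

/-- The automorphism scaling `ℤ/n` by a unit. -/
def scale (w : (ZMod n)ˣ) : MulAut (CyclicSemidirect n q g hg) where
  toFun x := el (w * x.left.toAdd) x.right.toAdd
  invFun x := el (↑w⁻¹ * x.left.toAdd) x.right.toAdd
  left_inv x := by
    obtain ⟨a, i, rfl⟩ := exists_el x
    exact el_inj.2 ⟨Units.inv_mul_cancel_left w a, rfl⟩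
  right_inv x := by
    obtain ⟨a, i, rfl⟩ := exists_el x
    exact el_inj.2 ⟨Units.mul_inv_cancel_left w a, rfl⟩
  map_mul' x y := by
    obtain ⟨a, i, rfl⟩ := exists_el x
    obtain ⟨b, j, rfl⟩ := exists_el y
    rw [el_mul, el_mul, el_inj]
    refine ⟨?_, rfl⟩
    change (w : ZMod n) * (a + scalar g i * b) = w * a + scalar g i * (w * b)
    ring

/-- The subgroup of the elements `(a, i)` with `a` in a given ideal of `ℤ/n`. -/
def idealSubgroup (I : Ideal (ZMod n)) : Subgroup (CyclicSemidirect n q g hg) where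
  carrier := {x | x.left.toAdd ∈ I}
  one_mem' := I.zero_mem
  mul_mem' {x y} hx hy := by
    obtain ⟨a, i, rfl⟩ := exists_el x
    obtain ⟨b, j, rfl⟩ := exists_el y
    rw [el_mul]
    exact I.add_mem hx (I.mul_mem_left _ hy)
  inv_mem' {x} hx := by
    obtain ⟨a, i, rfl⟩ := exists_el x
    rw [el_inv]
    exact I.neg_mem (I.mul_mem_left _ hx)

theorem el_mem_idealSubgroup {I : Ideal (ZMod n)} {a : ZMod n} {i : ZMod q} :
    (el a i : CyclicSemidirect n q g hg) ∈ idealSubgroup I ↔ a ∈ I := Iff.rfl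

/-- The dihedral group as a semidirect product. -/
noncomputable def dihedralEquiv (n : ℕ) (h : orderOf (-1 : (ZMod n)ˣ) = 2) :
    DihedralGroup n ≃* CyclicSemidirect n 2 (-1) h :=
  have h1 : scalar (-1 : (ZMod n)ˣ) (1 : ZMod 2) = -1 := by rw [scalar_one h]; simp
  have h0 : scalar (-1 : (ZMod n)ˣ) (0 : ZMod 2) = 1 := scalar_zero
  have h2 : (1 + 1 : ZMod 2) = 0 := rfl
  MulEquiv.ofBijective
    (MonoidHom.mk' (fun x => match x with
      | .r a => el a 0
      | .sr a => el (-a) 1) (by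
        rintro (a | a) (b | b)
        · simp [el_mul, h0]
        · simp [el_mul, h0]; ring_nf
        · simp [el_mul, h1]; ring_nf
        · simp [el_mul, h1, h2]; ring_nf))
    (by
      constructor
      · rintro (a | a) (b | b) hab
        · exact congrArg _ (el_inj.1 hab).1
        · exact absurd (el_inj.1 hab).2 (by decide)
        · exact absurd (el_inj.1 hab).2 (by decide)
        · exact congrArg _ (neg_injective (el_inj.1 hab).1)
      · intro x
        obtain ⟨a, i, rfl⟩ := exists_el x
        fin_cases i
        · exact ⟨.r a, rfl⟩
        · exact ⟨.sr (-a), el_inj.2 ⟨neg_neg a, rfl⟩⟩)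

end CyclicSemidirect

/-! ### Constructing solutions, and the models on the semidirect product. -/

namespace YBSolution

/-- The solution given by maps `σ x` that satisfy the cycle set equation. -/
def ofPerm {X : Type u} (hX : Nonempty X) (σ : X → Equiv.Perm X)
    (hσ : ∀ x y, σ x * σ y = σ (σ x y) * σ ((σ (σ x y))⁻¹ x))
    (hτ : ∀ y, Function.Bijective fun x => (σ (σ x y))⁻¹ x) : YBSolution.{u} :=
  have hinv : ∀ t : X × X, (fun t : X × X => (σ t.1 t.2, (σ (σ t.1 t.2))⁻¹ t.1))
      ((fun t : X × X => (σ t.1 t.2, (σ (σ t.1 t.2))⁻¹ t.1)) t) = t := by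
    rintro ⟨x, y⟩
    simp
  { X := X
    nonempty := hX
    r := fun t => (σ t.1 t.2, (σ (σ t.1 t.2))⁻¹ t.1)
    bijective := Function.Involutive.bijective hinv
    braid := by
      have hσ' : ∀ x y z, σ (σ x y) (σ ((σ (σ x y))⁻¹ x) z) = σ x (σ y z) := fun x y z =>
        (DFunLike.congr_fun (hσ x y) z).symm
      funext ⟨x, y, z⟩
      simp only [Function.comp_apply]
      rw [hσ' x y z]
      -- The hypothesis expresses `σ` of a second component of `r` through the other three
      -- permutations; this settles the second and third coordinates of the braid relation.
      have hv : σ ((σ (σ x (σ y z)))⁻¹ x) = (σ (σ x (σ y z)))⁻¹ * (σ x * σ (σ y z)) := by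
        rw [hσ x (σ y z), inv_mul_cancel_left]
      have h2 : σ ((σ (σ x (σ y z)))⁻¹ x) ((σ (σ y z))⁻¹ y) = (σ (σ x (σ y z)))⁻¹ (σ x y) := by
        rw [hv]
        simp
      rw [h2]
      have h3 := hσ (σ x y) (σ ((σ (σ x y))⁻¹ x) z)
      rw [hσ' x y z] at h3
      have h4 : (σ (σ ((σ (σ x y))⁻¹ x) z))⁻¹ * (σ (σ x y))⁻¹ =
          (σ ((σ (σ x (σ y z)))⁻¹ (σ x y)))⁻¹ * (σ (σ x (σ y z)))⁻¹ := by
        rw [← mul_inv_rev, ← mul_inv_rev, h3]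
      exact Prod.ext rfl (Prod.ext rfl (DFunLike.congr_fun h4 x))
    bijective_σ := fun x => (σ x).bijective
    bijective_τ := hτ
    involutive := hinv }

theorem ofPerm_σ {X : Type u} (hX : Nonempty X) (σ : X → Equiv.Perm X)
    (hσ : ∀ x y, σ x * σ y = σ (σ x y) * σ ((σ (σ x y))⁻¹ x))
    (hτ : ∀ y, Function.Bijective fun x => (σ (σ x y))⁻¹ x) (x : X) :
    (ofPerm hX σ hσ hτ).σ x = σ x := by
  ext y
  rfl

theorem Isomorphic.of_σ {S T : YBSolution.{u}} (f : S.X ≃ T.X)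
    (h : ∀ x y, f (S.σ x y) = T.σ (f x) (f y)) : Isomorphic S T := by
  refine ⟨f, fun x y => Prod.ext (h x y).symm ?_⟩
  rw [r_snd, r_snd, ← h, Equiv.Perm.inv_eq_iff_eq, ← h]
  simp

theorem Isomorphic.exists_mulEquiv {S T : YBSolution.{u}} (h : Isomorphic S T) :
    ∃ (f : S.X ≃ T.X) (ψ : S.permutationGroup ≃* T.permutationGroup),
      ∀ x, ψ ⟨S.σ x, Subgroup.subset_closure ⟨x, rfl⟩⟩ =
        ⟨T.σ (f x), Subgroup.subset_closure ⟨f x, rfl⟩⟩ := by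
  obtain ⟨f, hf⟩ := h
  have hσ : ∀ x, f.permCongrHom (S.σ x) = T.σ (f x) := by
    intro x
    ext y
    obtain ⟨y, rfl⟩ := f.surjective y
    have := congrArg Prod.fst (hf x y)
    simpa [Equiv.permCongrHom] using this.symm
  have hmap : S.permutationGroup.map f.permCongrHom.toMonoidHom = T.permutationGroup := by
    rw [permutationGroup, permutationGroup, MonoidHom.map_closure, ← Set.range_comp,
      ← f.surjective.range_comp T.σ]
    congr 2
    funext x
    exact hσ x
  exact ⟨f, (f.permCongrHom.subgroupMap S.permutationGroup).trans (MulEquiv.subgroupCongr hmap),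
    fun x => Subtype.ext (hσ x)⟩

/-- Used to turn the fact that the maps `σ x` generate into constraints on their coordinates in `G`.
-/
theorem eq_top_of_forall_mem {S : YBSolution.{u}} {G : Type*} [Group G]
    (E : G ≃* S.permutationGroup) (K : Subgroup G)
    (h : ∀ x, E.symm ⟨S.σ x, Subgroup.subset_closure ⟨x, rfl⟩⟩ ∈ K) : K = ⊤ := by
  have h1 : K.comap E.symm.toMonoidHom = ⊤ := by
    have h2 : Subgroup.closure ((↑) ⁻¹' Set.range S.σ : Set S.permutationGroup) = ⊤ :=
      Subgroup.closure_closure_coe_preimage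
    rw [eq_top_iff, ← h2]
    refine (Subgroup.closure_le _).2 ?_
    rintro ⟨_, hf⟩ ⟨x, rfl⟩
    exact h x
  rw [eq_top_iff]
  intro x _
  have : E x ∈ K.comap E.symm.toMonoidHom := h1 ▸ Subgroup.mem_top _
  simpa using this

section Model

open CyclicSemidirect

variable {n q : ℕ} {g : (ZMod n)ˣ} {hg : orderOf g = q}

/-- Left multiplication, as a permutation of a lift of the group to a given universe. -/
def leftMul : CyclicSemidirect n q g hg →* Equiv.Perm (ULift.{u} (CyclicSemidirect n q g hg)) :=
  MulAction.toPermHom _ _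

theorem leftMul_up (x y : CyclicSemidirect n q g hg) : leftMul x (ULift.up.{u} y) = ⟨x * y⟩ := rfl

theorem leftMul_injective :
    Function.Injective (leftMul.{u} : CyclicSemidirect n q g hg →* _) := fun x y h => by
  have := DFunLike.congr_fun h ⟨1⟩
  rw [leftMul_up, leftMul_up, mul_one, mul_one] at this
  exact congrArg ULift.down this

variable (hg) in
/-- The solution on the semidirect product in which `σ (a, i)` is the left multiplication by
`(g ^ i, j)`. -/
def model (j : ZMod q) : YBSolution.{u} :=
  ofPerm ⟨ULift.up (1 : CyclicSemidirect n q g hg)⟩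
    (fun x => leftMul (el (scalar g x.down.right.toAdd) j))
    (by
      rintro ⟨x⟩ ⟨y⟩
      obtain ⟨a, i, rfl⟩ := exists_el x
      obtain ⟨b, k, rfl⟩ := exists_el y
      rw [← map_inv, ← map_mul, ← map_mul, leftMul_up, leftMul_up, el_inv, el_mul, el_mul, el_mul,
        el_mul]
      congr 1
      refine el_inj.2 ⟨?_, rfl⟩
      change scalar g i + scalar g j * scalar g k =
        scalar g (j + k) + scalar g j * scalar g (-j + i)
      rw [← scalar_add hg, ← scalar_add hg, add_neg_cancel_left, add_comm])
    (by
      rintro ⟨y⟩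
      obtain ⟨b, k, rfl⟩ := exists_el y
      -- Every `σ x` shifts the second coordinate by the same `j`, so `σ (σ x y)` depends only on
      -- `y` and `τ y` is a left multiplication.
      refine (leftMul (el (scalar g (j + k)) j : CyclicSemidirect n q g hg))⁻¹.bijective)

theorem model_σ (j : ZMod q) (x : CyclicSemidirect n q g hg) :
    (model.{u} hg j).σ (ULift.up x) = leftMul (el (scalar g x.right.toAdd) j) := ofPerm_σ _ _ _ _ _

variable (hg) in
/-- Left multiplication, as a permutation of the underlying set of a model. -/
def modelHom (j : ZMod q) : CyclicSemidirect n q g hg →* Equiv.Perm (model.{u} hg j).X := leftMul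

theorem permutationGroup_model [NeZero n] (hq : q.Prime) (hu : IsUnit ((g : ZMod n) - 1))
    {j : ZMod q} (hj : j ≠ 0) :
    (model.{u} hg j).permutationGroup = (modelHom.{u} hg j).range := by
  rw [MonoidHom.range_eq_map, ← closure_range_eq_top hq hu hj, MonoidHom.map_closure,
    ← Set.range_comp]
  refine congrArg Subgroup.closure (Set.ext fun f => ⟨?_, ?_⟩)
  · rintro ⟨⟨x⟩, rfl⟩
    exact ⟨x.right.toAdd, (model_σ j x).symm⟩
  · rintro ⟨i, rfl⟩
    exact ⟨⟨el 0 i⟩, model_σ j (el 0 i)⟩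

theorem exists_mulEquiv_model [NeZero n] (hq : q.Prime) (hu : IsUnit ((g : ZMod n) - 1))
    {j : ZMod q} (hj : j ≠ 0) :
    ∃ e : (model.{u} hg j).permutationGroup ≃* CyclicSemidirect n q g hg,
      ∀ x, e ⟨(model.{u} hg j).σ (ULift.up x), Subgroup.subset_closure ⟨_, rfl⟩⟩ =
        el (scalar g x.right.toAdd) j := by
  refine ⟨(MulEquiv.subgroupCongr (permutationGroup_model hq hu hj)).trans
    (MonoidHom.ofInjective (f := modelHom.{u} hg j) leftMul_injective).symm, fun x => ?_⟩
  rw [MulEquiv.trans_apply, MulEquiv.symm_apply_eq]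
  exact Subtype.ext (model_σ j x)

theorem isIndecomposableWith_model [NeZero n] (hq : q.Prime) (hu : IsUnit ((g : ZMod n) - 1))
    {j : ZMod q} (hj : j ≠ 0) :
    (model.{u} hg j).IsIndecomposableWith (CyclicSemidirect n q g hg) := by
  refine ⟨?_, ⟨(exists_mulEquiv_model hq hu hj).choose⟩⟩
  rintro ⟨x⟩ ⟨y⟩
  refine ⟨leftMul (y * x⁻¹), ?_, ?_⟩
  · rw [permutationGroup_model hq hu hj]
    exact ⟨_, rfl⟩
  · exact (leftMul_up _ _).trans (congrArg _ (inv_mul_cancel_right y x))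

/-- An isomorphism of models induces an automorphism of `G` carrying some `(_, j)` to some `(_, k)`,
and automorphisms preserve second coordinates. -/
theorem eq_of_isomorphic_model [NeZero n] (hnq : n.Coprime q) (hq : q.Prime)
    (hu : IsUnit ((g : ZMod n) - 1)) {j k : ZMod q} (hj : j ≠ 0) (hk : k ≠ 0)
    (h : Isomorphic (model.{u} hg j) (model.{u} hg k)) : j = k := by
  obtain ⟨f, ψ, hψ⟩ := h.exists_mulEquiv
  obtain ⟨e, he⟩ := exists_mulEquiv_model.{u} (hg := hg) hq hu hj
  obtain ⟨e', he'⟩ := exists_mulEquiv_model.{u} (hg := hg) hq hu hk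
  obtain ⟨b, hb⟩ := exists_mulEquiv_el hnq ((e.symm.trans ψ).trans e')
    (scalar g (0 : ZMod q)) j
  have h1 := he 1
  have h2 := hψ ⟨1⟩
  rw [← e.eq_symm_apply] at h1
  have h3 : ((e.symm.trans ψ).trans e') (el (scalar g (0 : ZMod q)) j) =
      e' (ψ (e.symm (el (scalar g (0 : ZMod q)) j))) := rfl
  rw [h3] at hb
  erw [← h1, h2, he'] at hb
  exact (el_inj.1 hb).2.symm

end Model

/-! ### Every indecomposable solution is a model. -/

section Classification

open CyclicSemidirect

variable {p q : ℕ} {g : (ZMod (p ^ 2))ˣ} {hg : orderOf g = q}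

/-- In the coordinates of the unique brace, `σ x₀ = (b, j)` and the other `σ x` are the translates
`(g ^ i * b, j)`. Testing generation against the kernel of the projection to `ℤ/q` gives `j ≠ 0`,
and against the subgroup of the ideal `(b)` gives that `b` is a unit. -/
theorem exists_mulEquiv_σ {S : YBSolution.{u}} (hp : p.Prime) (hodd : Odd p) (hq : q.Prime)
    (hqp : q < p) (e : S.permutationGroup ≃* CyclicSemidirect (p ^ 2) q g hg)
    (hS : S.Indecomposable) (x₀ : S.X) :
    ∃ (E : CyclicSemidirect (p ^ 2) q g hg ≃* S.permutationGroup) (j : ZMod q), j ≠ 0 ∧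
      ∀ a i, S.σ ((E (el a i)).1 x₀) = (E (el (scalar g i) j)).1 := by
  have := NeZero.mk hq.ne_zero
  have := Fact.mk hq
  have := NeZero.mk (pow_ne_zero 2 hp.ne_zero)
  have : Finite S.permutationGroup := Finite.of_equiv _ e.symm.toEquiv
  obtain ⟨A, _, c, hc⟩ := S.exists_bijectiveCocycle
  obtain ⟨θ, hθ⟩ := (c.comp e.symm).exists_mulAut hp hodd hq hqp
  let E : CyclicSemidirect (p ^ 2) q g hg ≃* S.permutationGroup := θ.trans e.symm
  replace hθ : ∀ a b i j, c.act (E (el a i)) (c.toEquiv (E (el b j))) =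
    c.toEquiv (E (el (scalar g i * b) j)) := hθ
  obtain ⟨b, j, hbj⟩ := exists_el (E.symm ⟨S.σ x₀, Subgroup.subset_closure ⟨x₀, rfl⟩⟩)
  rw [MulEquiv.symm_apply_eq] at hbj
  have key : ∀ a i, (⟨S.σ ((E (el a i)).1 x₀), Subgroup.subset_closure ⟨_, rfl⟩⟩ :
      S.permutationGroup) = E (el (scalar g i * b) j) := by
    intro a i
    apply c.toEquiv.injective
    rw [← hc, hbj, hθ]
  have htrans : ∀ x, ∃ a i, (E (el a i)).1 x₀ = x := by
    intro x
    obtain ⟨f, hf, hx⟩ := hS x₀ x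
    obtain ⟨y, hy⟩ := E.surjective ⟨f, hf⟩
    obtain ⟨a, i, rfl⟩ := exists_el y
    exact ⟨a, i, by rw [hy, hx]⟩
  have hgen : ∀ K : Subgroup (CyclicSemidirect (p ^ 2) q g hg),
      (∀ i : ZMod q, el (scalar g i * b) j ∈ K) → K = ⊤ := by
    intro K hK
    refine eq_top_of_forall_mem E K fun x => ?_
    obtain ⟨a, i, rfl⟩ := htrans x
    rw [key, MulEquiv.symm_apply_apply]
    exact hK i
  have hj : j ≠ 0 := by
    rintro rfl
    have h := hgen (SemidirectProduct.rightHom.ker) fun i => rfl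
    have h1 : (el 0 1 : CyclicSemidirect (p ^ 2) q g hg) ∈ SemidirectProduct.rightHom.ker :=
      h ▸ Subgroup.mem_top _
    exact one_ne_zero (α := ZMod q) (congrArg Multiplicative.toAdd h1)
  have hb : IsUnit b := by
    have h := hgen (idealSubgroup (Ideal.span {b})) fun i =>
      el_mem_idealSubgroup.2 (Ideal.mul_mem_left _ _ (Ideal.mem_span_singleton_self b))
    have h1 : (el 1 0 : CyclicSemidirect (p ^ 2) q g hg) ∈ idealSubgroup (Ideal.span {b}) :=
      h ▸ Subgroup.mem_top _
    exact isUnit_of_dvd_one (Ideal.mem_span_singleton.1 (el_mem_idealSubgroup.1 h1))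
  obtain ⟨w, rfl⟩ := hb
  -- Scaling the first coordinate by `w` commutes with multiplication by `g ^ i`, so it normalizes
  -- `b` to `1`.
  refine ⟨(scale w).trans E, j, hj, fun a i => ?_⟩
  have h := congrArg Subtype.val (key (w * a) i)
  rw [mul_comm (scalar g i)] at h
  exact h

theorem exists_equiv {S : YBSolution.{u}} (hp : p.Prime) (hodd : Odd p) (hq : q.Prime)
    (hqp : q < p) (hS : S.IsIndecomposableWith (CyclicSemidirect (p ^ 2) q g hg)) :
    ∃ (F : CyclicSemidirect (p ^ 2) q g hg ≃ S.X) (j : ZMod q), j ≠ 0 ∧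
      ∀ x y, S.σ (F x) (F y) = F (el (scalar g x.right.toAdd) j * y) := by
  have := NeZero.mk (pow_ne_zero 2 hp.ne_zero)
  obtain ⟨hind, ⟨e⟩⟩ := hS
  obtain ⟨x₀⟩ := S.nonempty
  obtain ⟨E, j, hj, hE⟩ := exists_mulEquiv_σ hp hodd hq hqp e hind x₀
  have hmul : ∀ x y, (E (x * y)).1 x₀ = (E x).1 ((E y).1 x₀) := by
    intro x y
    rw [map_mul]
    rfl
  have hsurj : ∀ x, ∃ y, (E y).1 x₀ = x := by
    intro x
    obtain ⟨f, hf, hx⟩ := hind x₀ x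
    obtain ⟨y, hy⟩ := E.surjective ⟨f, hf⟩
    exact ⟨y, by rw [hy, hx]⟩
  -- If `(a, i)` fixes `x₀`, comparing `σ x₀` with its translate gives `g ^ i = 1`, so `i = 0`.
  have hstab : ∀ h, (E h).1 x₀ = x₀ → h = 1 := by
    intro h hh
    obtain ⟨a, i, rfl⟩ := exists_el h
    have h1 := hE a i
    have h2 := hE 0 0
    rw [hh] at h1
    rw [el_zero, map_one] at h2
    have h3 := (h1.symm.trans h2 : (E (el (scalar g i) j)).1 = _)
    have h4 := scalar_injective hg (el_inj.1 (E.injective (Subtype.ext h3))).1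
    subst h4
    have hpow : ∀ k : ℕ, (E (el a 0 ^ k)).1 x₀ = x₀ := by
      intro k
      induction k with
      | zero => rw [pow_zero, map_one]; rfl
      | succ k ih => rw [pow_succ (el a 0), hmul, hh, ih]
    -- The subgroup generated by `(a, 0)` is normal and fixes `x₀`, so by transitivity it fixes
    -- every point.
    have h5 : E (el a 0) = 1 := by
      refine Subtype.ext (Equiv.ext fun x => ?_)
      obtain ⟨y, rfl⟩ := hsurj x
      obtain ⟨b, i, hy⟩ := exists_el y⁻¹
      have h6 : el a 0 * y = y * el a 0 ^ (scalar g i).val := by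
        rw [el_pow, ZMod.natCast_zmod_val, ← el_conj (hg := hg) b a i, ← hy]
        group
      rw [← hmul, h6, hmul, hpow]
      rfl
    exact E.injective (h5.trans (map_one E).symm)
  refine ⟨Equiv.ofBijective (fun x => (E x).1 x₀) ⟨fun x y hxy => ?_, hsurj⟩, j, hj, ?_⟩
  · refine inv_mul_eq_one.1 (hstab (x⁻¹ * y) ?_)
    rw [hmul, ← (show (E x).1 x₀ = (E y).1 x₀ from hxy), ← hmul, inv_mul_cancel, map_one]
    rfl
  · intro x y
    obtain ⟨a, i, rfl⟩ := exists_el x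
    change S.σ ((E (el a i)).1 x₀) ((E y).1 x₀) = (E (el (scalar g i) j * y)).1 x₀
    rw [hE, hmul]

theorem exists_isomorphic_model {S : YBSolution.{u}} (hp : p.Prime) (hodd : Odd p) (hq : q.Prime)
    (hqp : q < p) (hS : S.IsIndecomposableWith (CyclicSemidirect (p ^ 2) q g hg)) :
    ∃ j : ZMod q, j ≠ 0 ∧ Isomorphic (model hg j) S := by
  obtain ⟨F, j, hj, hF⟩ := exists_equiv hp hodd hq hqp hS
  refine ⟨j, hj, Isomorphic.of_σ (Equiv.ulift.trans F) ?_⟩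
  rintro ⟨x⟩ ⟨y⟩
  rw [model_σ]
  exact (hF x y).symm

theorem card_of_isIndecomposableWith {S : YBSolution.{u}} (hp : p.Prime) (hodd : Odd p)
    (hq : q.Prime) (hqp : q < p)
    (hS : S.IsIndecomposableWith (CyclicSemidirect (p ^ 2) q g hg)) :
    Nat.card S.X = p ^ 2 * q := by
  have := NeZero.mk hq.ne_zero
  have := NeZero.mk (pow_ne_zero 2 hp.ne_zero)
  obtain ⟨F, -⟩ := exists_equiv hp hodd hq hqp hS
  rw [← Nat.card_congr F, card_eq]

theorem IsIndecomposableWith.congr {G H : Type*} [Group G] [Group H] (e : G ≃* H)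
    {S : YBSolution.{u}} (hS : S.IsIndecomposableWith G) : S.IsIndecomposableWith H :=
  ⟨hS.1, hS.2.map fun f => f.trans e⟩

theorem card_indecomposableClasses {G : Type*} [Group G] (hp : p.Prime) (hodd : Odd p)
    (hq : q.Prime) (hqp : q < p) (e : G ≃* CyclicSemidirect (p ^ 2) q g hg) :
    Nat.card (IndecomposableClasses.{u} G) = q - 1 := by
  have := Fact.mk hq
  have := NeZero.mk (pow_ne_zero 2 hp.ne_zero)
  have hpq : p.Coprime q := (Nat.coprime_primes hp hq).2 hqp.ne'
  have hu := isUnit_sub_one_of_orderOf hp hq.one_lt.ne' hpq hg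
  let F : {j : ZMod q // j ≠ 0} → IndecomposableClasses.{u} G := fun j =>
    Quotient.mk (isoSetoid G) ⟨model hg j.1, (isIndecomposableWith_model hq hu j.2).congr e.symm⟩
  have hF : Function.Bijective F := by
    constructor
    · intro j k h
      exact Subtype.ext
        (eq_of_isomorphic_model (hpq.pow_left 2) hq hu j.2 k.2 (Quotient.exact h))
    · intro S
      induction S using Quotient.inductionOn with
      | h S =>
        obtain ⟨j, hj, h⟩ := exists_isomorphic_model hp hodd hq hqp (S.2.congr e)
        exact ⟨⟨j, hj⟩, Quotient.sound h⟩
  rw [← Nat.card_congr (Equiv.ofBijective F hF), Nat.card_eq_fintype_card,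
    Fintype.card_subtype_compl, ZMod.card, Fintype.card_subtype_eq]

end Classification

end YBSolution

theorem mainTheorem5 :
    (∀ p q : ℕ, p.Prime → q.Prime → p ≡ 1 [MOD q] →
      ∀ (g : (ZMod (p ^ 2))ˣ) (hg : orderOf g = q),
        Nat.card (YBSolution.IndecomposableClasses.{u} (CyclicSemidirect (p ^ 2) q g hg)) = q - 1 ∧
        ∀ S : YBSolution.{u}, S.IsIndecomposableWith (CyclicSemidirect (p ^ 2) q g hg) →
          Nat.card S.X = p ^ 2 * q) ∧
    (∀ p : ℕ, p.Prime → Odd p →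
      Nat.card (YBSolution.IndecomposableClasses.{u} (DihedralGroup (p ^ 2))) = 1 ∧
      ∀ S : YBSolution.{u}, S.IsIndecomposableWith (DihedralGroup (p ^ 2)) →
        Nat.card S.X = 2 * p ^ 2) := by
  constructor
  · intro p q hp hq hmod g hg
    -- The congruence enters only through `q ∣ p - 1`, which gives `q < p` and hence `p` odd.
    have hqp : q < p := by
      have h := Nat.le_of_dvd (by have := hp.two_le; lia)
        ((Nat.modEq_iff_dvd' hp.one_le).1 hmod.symm)
      have := hp.two_le
      lia
    have hodd : Odd p := hp.odd_of_ne_two fun h => by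
      have := hq.two_le
      lia
    exact ⟨YBSolution.card_indecomposableClasses hp hodd hq hqp (MulEquiv.refl _),
      fun S => YBSolution.card_of_isIndecomposableWith hp hodd hq hqp⟩
  · intro p hp hodd
    have hp2 : 2 < p := by
      have := hp.two_le
      obtain ⟨m, rfl⟩ := hodd
      lia
    have hord : orderOf (-1 : (ZMod (p ^ 2))ˣ) = 2 := by
      have : Fact (2 < p ^ 2) := ⟨by nlinarith⟩
      refine orderOf_eq_prime (by simp) fun h => ZMod.neg_one_ne_one (n := p ^ 2) ?_
      simpa using congrArg Units.val h
    have e := CyclicSemidirect.dihedralEquiv (p ^ 2) hord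
    exact ⟨YBSolution.card_indecomposableClasses hp hodd Nat.prime_two hp2 e,
      fun S hS => (YBSolution.card_of_isIndecomposableWith hp hodd Nat.prime_two hp2
        (hS.congr e)).trans (mul_comm _ _)⟩
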